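/- Theorem 1.1. For every real $0<\delta<1$ there is an integer $n_0=n_0(\delta)$ such that the following holds. Let $G$ be a finite simple graph on $n\ge n_0$ vertices with minimum degree at least $\delta n$ and chromatic number $\chi(G)>32/\delta$. Then for every positive integer $$b\le \frac{\delta^2 n}{6400(\log_2 n)^2},$$ Maker has a winning strategy in the $(1:b)$ odd cycle game on $G$. This is the following game. Maker and Breaker alternately claim previously unclaimed edges of $G$, Maker moving first; in each turn Maker claims exactly one edge and Breaker exactly $b$ edges (or all remaining edges, if fewer than the required number remain), until all edges are claimed. Maker wins if the edges claimed by him contain the edge set of a subgraph of $G$ that is not $2$-colorable (equivalently, if they contain an odd cycle), and Breaker wins otherwise. -/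

import Mathlib

namespace MakerBreaker

variable {α : Type*} [DecidableEq α]

/-- `T` is a legal move, on the board `X` whose elements in `C` are already claimed, of a player
who claims `q` elements per turn: `T` consists of exactly `q` unclaimed elements, or of all the
unclaimed elements if fewer than `q` of them are left. -/
def IsMove (X C : Finset α) (q : ℕ) (T : Finset α) : Prop :=
  T ⊆ X \ C ∧ T.card = min q (X \ C).card

/-- A strategy of Maker (the first player): to each position with Maker to move, given by the set
`M` of Maker's elements and the set `B` of Breaker's elements, it assigns the set of elements that
Maker claims next. -/
abbrev Strategy (α : Type*) := Finset α → Finset α → Finset α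

/-- `Reachable X b σ M B`: on the board `X`, when Maker moves first and follows `σ` and Breaker
plays arbitrary legal moves of `b` elements, the position `(M, B)` can occur with Maker to move. -/
inductive Reachable (X : Finset α) (b : ℕ) (σ : Strategy α) : Finset α → Finset α → Prop
  | start : Reachable X b σ ∅ ∅
  | round {M B : Finset α} (S : Finset α) (h : Reachable X b σ M B)
      (hS : IsMove X ((M ∪ σ M B) ∪ B) b S) : Reachable X b σ (M ∪ σ M B) (B ∪ S)

/-- `σ` is a winning strategy of Maker, who moves first, in the `(a : b)` game `(X, F)`: whatever
Breaker does, the moves prescribed by `σ` are legal, and once the whole board has been claimed,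
Maker has claimed all elements of some winning set. -/
structure IsWinningStrategy (X : Finset α) (F : Set (Finset α)) (a b : ℕ) (σ : Strategy α) :
    Prop where
  legal : ∀ M B, Reachable X b σ M B → IsMove X (M ∪ B) a (σ M B)
  wins : ∀ M B, Reachable X b σ M B → X ⊆ M ∪ B → ∃ A ∈ F, A ⊆ M

/-- Maker, as first player, has a winning strategy in the `(a : b)` Maker-Breaker game on the
board `X` with family of winning sets `F` (for positive integers `a` and `b`). -/
def MakerHasWinningStrategy (X : Finset α) (F : Set (Finset α)) (a b : ℕ) : Prop :=
  ∃ σ : Strategy α, IsWinningStrategy X F a b σ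

/-- The winning sets of the non-`k`-colorability game on `G`: the edge sets of the subgraphs of
`G` that are not `k`-colorable. (Isolated vertices do not matter for this, so only spanning
subgraphs are considered.) For `k = 2` this is the odd cycle game. -/
def nonColorable {V : Type*} (G : SimpleGraph V) (k : ℕ) : Set (Finset (Sym2 V)) :=
  {A | ∃ H : SimpleGraph V, H ≤ G ∧ ¬ H.Colorable k ∧ (A : Set (Sym2 V)) = H.edgeSet}

end MakerBreaker

/-! Maker's graph is non-bipartite exactly when it meets the monochromatic edges of every
2-colouring `φ`, so Maker plays a hitting game. By the biased Erdős–Selfridge criterion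
(`makerHasWinningStrategy_hitting`) it suffices to find a first edge `uv` such that the weights `2 ^
(-m_φ / b)` of the colourings separating `u` from `v` sum to less than 1/2, with `m_φ` the number of
monochromatic edges.

`exists_adj_codegree` supplies an edge `uv` and a vertex `r` having large codegree with both ends. A
colouring separating `u` from `v` separates one of them from `r`, which forces a bad vertex, one
with at least `δ²n/8` neighbours of its own colour. With `d ≥ 1` bad vertices, `m_φ ≥ dδ²n/16`. Such
colourings are few: the colours of the bad vertices and of fewer than `2/δ` representatives
determine `φ` (`eq_of_partialColoring_eq`). The gain in weight beats this count. -/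

namespace MakerBreaker

/-! ### The biased hitting game -/

section Hitting

variable {α ι : Type*}

/-- The weight of a winning set of which `s` elements are not yet claimed by Breaker. -/
noncomputable def weight (b : ℕ) (s : Finset α) : ℝ := 2 ^ (-(s.card : ℝ) / b)

lemma weight_nonneg (b : ℕ) (s : Finset α) : 0 ≤ weight b s := by
  unfold weight; positivity

variable [DecidableEq α] [Fintype ι]

/-- The total weight of the sets `A i` that Maker has not hit yet. -/
noncomputable def potential (A : ι → Finset α) (b : ℕ) (M B : Finset α) : ℝ :=
  ∑ i with Disjoint (A i) M, weight b (A i \ B)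

/-- The part of the potential that comes from the sets containing `e`. -/
noncomputable def danger (A : ι → Finset α) (b : ℕ) (M B : Finset α) (e : α) : ℝ :=
  ∑ i with Disjoint (A i) M, if e ∈ A i then weight b (A i \ B) else 0

lemma danger_nonneg (A : ι → Finset α) (b : ℕ) (M B : Finset α) (e : α) :
    0 ≤ danger A b M B e :=
  Finset.sum_nonneg fun i _ => by split_ifs <;> simp [weight_nonneg]

lemma danger_le_potential (A : ι → Finset α) (b : ℕ) (M B : Finset α) (e : α) :
    danger A b M B e ≤ potential A b M B :=
  Finset.sum_le_sum fun i _ => by split_ifs <;> simp [weight_nonneg]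

lemma danger_anti (A : ι → Finset α) (b : ℕ) {M M' : Finset α} (h : M ⊆ M') (B : Finset α)
    (e : α) : danger A b M' B e ≤ danger A b M B e :=
  Finset.sum_le_sum_of_subset_of_nonneg
    (fun i hi => by
      simp only [Finset.mem_filter, Finset.mem_univ, true_and] at hi ⊢
      exact hi.mono_right h)
    (fun i _ _ => by split_ifs <;> simp [weight_nonneg])

lemma potential_union_singleton (A : ι → Finset α) (b : ℕ) (M B : Finset α) (e : α) :
    potential A b (M ∪ {e}) B = potential A b M B - danger A b M B e := by
  unfold potential danger
  rw [← Finset.sum_sub_distrib, Finset.sum_filter, Finset.sum_filter]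
  refine Finset.sum_congr rfl fun i _ => ?_
  by_cases h : Disjoint (A i) M <;> by_cases he : e ∈ A i <;>
    simp [h, he]

/-- Losing `j ≤ b` further elements multiplies the weight by `2 ^ (j / b)`, which Bernoulli bounds
by `1 + j / b`. -/
lemma weight_sdiff_union_le {b : ℕ} (hb : 0 < b) (s B : Finset α) {S : Finset α}
    (hS : S.card ≤ b) :
    weight b (s \ (B ∪ S)) ≤
      weight b (s \ B) + (1 / b) * ∑ f ∈ S, if f ∈ s then weight b (s \ B) else 0 := by
  have hb' : (0 : ℝ) < b := by exact_mod_cast hb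
  set j := ((s \ B) ∩ S).card
  have hcard : ((s \ (B ∪ S)).card : ℝ) + j = (s \ B).card := by
    have : s \ (B ∪ S) = (s \ B) \ S := by
      ext
      simp only [Finset.mem_sdiff, Finset.mem_union]
      tauto
    rw [this]
    exact_mod_cast Finset.card_sdiff_add_card_inter (s \ B) S
  have hj : (j : ℝ) ≤ b := by
    exact_mod_cast (Finset.card_le_card Finset.inter_subset_right).trans hS
  have hjs : (j : ℝ) ≤ (S.filter (· ∈ s)).card := by
    refine mod_cast Finset.card_le_card fun f hf => ?_
    simp only [Finset.mem_inter, Finset.mem_sdiff, Finset.mem_filter] at hf ⊢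
    tauto
  have hsum : (∑ f ∈ S, if f ∈ s then weight b (s \ B) else 0)
      = (S.filter (· ∈ s)).card * weight b (s \ B) := by
    rw [← Finset.sum_filter, Finset.sum_const, nsmul_eq_mul]
  have hbern : (2 : ℝ) ^ ((j : ℝ) / b) ≤ 1 + j / b := by
    have := rpow_one_add_le_one_add_mul_self (s := 1) (p := (j : ℝ) / b) (by norm_num)
      (by positivity) ((div_le_one hb').2 hj)
    norm_num at this
    exact this
  have hw : weight b (s \ (B ∪ S)) = weight b (s \ B) * 2 ^ ((j : ℝ) / b) := by
    unfold weight
    rw [← Real.rpow_add two_pos]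
    congr 1
    rw [← hcard]
    ring
  have h0 := weight_nonneg b (s \ B)
  rw [hw, hsum]
  calc weight b (s \ B) * 2 ^ ((j : ℝ) / b) ≤ weight b (s \ B) * (1 + j / b) := by gcongr
    _ ≤ weight b (s \ B) * (1 + (S.filter (· ∈ s)).card / b) := by gcongr
    _ = _ := by ring

lemma potential_union_right_le {b : ℕ} (hb : 0 < b) (A : ι → Finset α) (M B : Finset α)
    {S : Finset α} (hS : S.card ≤ b) :
    potential A b M (B ∪ S) ≤ potential A b M B + (1 / b) * ∑ f ∈ S, danger A b M B f := by
  unfold potential danger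
  rw [Finset.sum_comm, Finset.mul_sum, ← Finset.sum_add_distrib]
  exact Finset.sum_le_sum fun i _ => weight_sdiff_union_le hb (A i) B hS

lemma potential_union_right_le_add {b : ℕ} (hb : 0 < b) (A : ι → Finset α) (M B : Finset α)
    {S : Finset α} (hS : S.card ≤ b) {c : ℝ} (hc : 0 ≤ c) (h : ∀ f ∈ S, danger A b M B f ≤ c) :
    potential A b M (B ∪ S) ≤ potential A b M B + c := by
  have hb' : (0 : ℝ) < b := by exact_mod_cast hb
  refine (potential_union_right_le hb A M B hS).trans ?_
  gcongr
  calc (1 / b : ℝ) * ∑ f ∈ S, danger A b M B f ≤ (1 / b) * (S.card * c) := by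
        gcongr
        simpa using Finset.sum_le_card_nsmul S _ c h
    _ ≤ (1 / b) * (b * c) := by gcongr
    _ = c := by field_simp

/-- A round in which Maker claims the most dangerous element does not increase the potential. -/
lemma potential_round_le {b : ℕ} (hb : 0 < b) (A : ι → Finset α) (M B : Finset α) {e : α}
    {S : Finset α} (hS : S.card ≤ b) (h : ∀ f ∈ S, danger A b M B f ≤ danger A b M B e) :
    potential A b (M ∪ {e}) (B ∪ S) ≤ potential A b M B := by
  have := potential_union_right_le_add hb A (M ∪ {e}) B hS (danger_nonneg A b M B e)
    fun f hf => (danger_anti A b Finset.subset_union_left B f).trans (h f hf)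
  rw [potential_union_singleton A b M B] at this
  linarith

lemma exists_most_dangerous (A : ι → Finset α) (b : ℕ) (M B : Finset α) {U : Finset α}
    (hU : U.Nonempty) : ∃ e ∈ U, ∀ f ∈ U, danger A b M B f ≤ danger A b M B e :=
  Finset.exists_max_image U _ hU

open Classical in
/-- Maker claims `e₀` in his first move, and a most dangerous element in every later one. -/
noncomputable def dangerStrategy (X : Finset α) (A : ι → Finset α) (b : ℕ) (e₀ : α) :
    Strategy α := fun M B =>
  if M = ∅ then {e₀} else
    if h : (X \ (M ∪ B)).Nonempty then {(exists_most_dangerous A b M B h).choose} else ∅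

lemma IsMove.card_le {X C T : Finset α} {q : ℕ} (h : IsMove X C q T) : T.card ≤ q :=
  h.2.trans_le (min_le_left _ _)

lemma dangerStrategy_reachable {X : Finset α} {A : ι → Finset α} {b : ℕ} (hb : 0 < b) {e₀ : α}
    (he₀ : e₀ ∈ X) (h : ∑ i with e₀ ∉ A i, weight b (A i) < 1 / 2) {M B : Finset α}
    (hr : Reachable X b (dangerStrategy X A b e₀) M B) :
    (M = ∅ ∧ B = ∅) ∨ (M ⊆ X ∧ e₀ ∈ M ∧ potential A b M B < 1) := by
  induction hr with
  | start => exact Or.inl ⟨rfl, rfl⟩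
  | @round M B S _ hS ih =>
    right
    have hSb := hS.card_le
    rcases ih with ⟨rfl, rfl⟩ | ⟨hM, he, hP⟩
    · have hσ : dangerStrategy X A b e₀ ∅ ∅ = {e₀} := by simp [dangerStrategy]
      rw [hσ]
      refine ⟨by simpa using he₀, by simp, ?_⟩
      have h0 : potential A b (∅ ∪ {e₀}) ∅ < 1 / 2 := by
        simpa [potential, Finset.disjoint_singleton_right] using h
      -- The first move need not be the most dangerous one, so Breaker's reply may double the
      -- potential; hence the bound 1/2.
      have := potential_union_right_le_add hb A (∅ ∪ {e₀}) ∅ hSb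
        ((danger_nonneg A b _ _ e₀).trans (danger_le_potential A b _ _ e₀))
        fun f _ => danger_le_potential A b _ _ f
      linarith
    · have hM0 : M ≠ ∅ := Finset.ne_empty_of_mem he
      by_cases hU : (X \ (M ∪ B)).Nonempty
      · have hσ : dangerStrategy X A b e₀ M B = {(exists_most_dangerous A b M B hU).choose} := by
          simp [dangerStrategy, hM0, hU]
        obtain ⟨hmem, hmax⟩ := (exists_most_dangerous A b M B hU).choose_spec
        rw [hσ] at hS ⊢
        refine ⟨Finset.union_subset hM ?_, Finset.mem_union_left _ he, ?_⟩
        · exact Finset.singleton_subset_iff.2 (Finset.sdiff_subset hmem)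
        · refine (potential_round_le hb A M B hSb fun f hf => hmax f ?_).trans_lt hP
          have := hS.1 hf
          simp only [Finset.mem_sdiff, Finset.mem_union] at this ⊢
          tauto
      · have hσ : dangerStrategy X A b e₀ M B = ∅ := by simp [dangerStrategy, hM0, hU]
        rw [Finset.not_nonempty_iff_eq_empty] at hU
        rw [hσ, Finset.union_empty] at hS ⊢
        have : S = ∅ := Finset.subset_empty.1 (hU ▸ hS.1)
        rw [this, Finset.union_empty]
        exact ⟨hM, he, hP⟩

/-- The biased Erdős–Selfridge criterion for a player who claims one element per turn, moves
first, and wants to hit all the sets `A i`. -/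
theorem makerHasWinningStrategy_hitting (X : Finset α) (A : ι → Finset α) (hA : ∀ i, A i ⊆ X)
    {b : ℕ} (hb : 0 < b) {e₀ : α} (he₀ : e₀ ∈ X)
    (h : ∑ i with e₀ ∉ A i, weight b (A i) < 1 / 2) :
    MakerHasWinningStrategy X {T | T ⊆ X ∧ e₀ ∈ T ∧ ∀ i, ¬ Disjoint (A i) T} 1 b := by
  refine ⟨dangerStrategy X A b e₀, ?_, ?_⟩
  · intro M B hr
    rcases dangerStrategy_reachable hb he₀ h hr with ⟨rfl, rfl⟩ | ⟨hM, he, -⟩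
    · have : 0 < X.card := Finset.card_pos.2 ⟨_, he₀⟩
      simp only [dangerStrategy, IsMove, if_true, Finset.union_empty, Finset.sdiff_empty,
        Finset.singleton_subset_iff, Finset.card_singleton]
      exact ⟨he₀, by omega⟩
    · have hM0 : M ≠ ∅ := Finset.ne_empty_of_mem he
      by_cases hU : (X \ (M ∪ B)).Nonempty
      · have := Finset.card_pos.2 hU
        simp only [dangerStrategy, IsMove, hM0, hU, if_false, dif_pos,
          Finset.singleton_subset_iff, Finset.card_singleton]
        exact ⟨(exists_most_dangerous A b M B hU).choose_spec.1, by omega⟩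
      · have := Finset.not_nonempty_iff_eq_empty.1 hU
        simp [dangerStrategy, IsMove, hM0, this]
  · intro M B hr hX
    rcases dangerStrategy_reachable hb he₀ h hr with ⟨rfl, rfl⟩ | ⟨hM, he, hP⟩
    · simpa using hX he₀
    · refine ⟨M, ⟨hM, he, fun i hi => hP.not_ge ?_⟩, subset_rfl⟩
      have hAB : A i \ B = ∅ := by
        rw [Finset.sdiff_eq_empty_iff_subset]
        intro f hf
        exact (Finset.mem_union.1 (hX (hA i hf))).resolve_left (Finset.disjoint_left.1 hi hf)
      calc (1 : ℝ) = weight b (A i \ B) := by simp [weight, hAB]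
        _ ≤ potential A b M B :=
          Finset.single_le_sum (f := fun i => weight b (A i \ B))
            (fun i _ => weight_nonneg b _) (by simpa using hi)

end Hitting

end MakerBreaker

/-! ### Codegrees and monochromatic edges -/

namespace SimpleGraph

variable {V : Type*} [Fintype V] [DecidableEq V] (G : SimpleGraph V) [DecidableRel G.Adj]

/-- The number of common neighbours of two vertices; `G.codegree v v` is the degree of `v`. -/
def codegree (u v : V) : ℕ := (G.neighborFinset u ∩ G.neighborFinset v).card

lemma sum_codegree (R : Finset V) :
    ∑ r ∈ R, ∑ s ∈ R, G.codegree r s = ∑ w, (R.filter (G.Adj w)).card ^ 2 := by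
  have h1 : ∀ r s, G.codegree r s
      = ∑ w, (if G.Adj w r then 1 else 0) * (if G.Adj w s then 1 else 0) := by
    intro r s
    simp only [codegree, ← Finset.card_filter, ite_mul, one_mul, zero_mul, ← ite_and]
    congr 1
    ext w
    simp [G.adj_comm w]
  simp_rw [h1, Finset.card_filter, sq, Finset.sum_mul_sum]
  exact (Finset.sum_congr rfl fun _ _ => Finset.sum_comm).trans Finset.sum_comm

omit [DecidableEq V] in
lemma sum_degree_eq (R : Finset V) :
    ∑ r ∈ R, G.degree r = ∑ w, (R.filter (G.Adj w)).card := by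
  simp_rw [Finset.card_filter]
  rw [Finset.sum_comm]
  refine Finset.sum_congr rfl fun r _ => ?_
  rw [← Finset.card_filter, ← G.card_neighborFinset_eq_degree]
  congr 1
  ext w
  simp [G.adj_comm w]

/-- In a graph of minimum degree at least `δn`, a set of vertices with pairwise codegrees below
`δ²n/4` has fewer than `2/δ` elements. -/
lemma card_mul_lt_two_of_codegree_lt {δ : ℝ} (hδ : 0 < δ) [Nonempty V]
    (hdeg : ∀ v, δ * Fintype.card V ≤ G.degree v) {R : Finset V}
    (hR : ∀ r ∈ R, ∀ s ∈ R, r ≠ s → (G.codegree r s : ℝ) < δ ^ 2 / 4 * Fintype.card V) :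
    R.card * δ < 2 := by
  by_contra! hcon
  have hn : (0 : ℝ) < Fintype.card V := by exact_mod_cast Fintype.card_pos
  set n : ℝ := (Fintype.card V : ℝ)
  set k : ℝ := (R.card : ℝ)
  have hk : 0 < k := by
    by_contra! h
    nlinarith
  set X : ℝ := ∑ r ∈ R, (G.degree r : ℝ)
  have hX : k * δ * n ≤ X := by
    calc k * δ * n = ∑ _r ∈ R, δ * n := by simp [k]; ring
      _ ≤ X := Finset.sum_le_sum fun r _ => hdeg r
  have hXw : X = ∑ w, ((R.filter (G.Adj w)).card : ℝ) := by
    simp only [X]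
    exact_mod_cast G.sum_degree_eq R
  have hCS : X ^ 2 ≤ n * ∑ w, ((R.filter (G.Adj w)).card : ℝ) ^ 2 := by
    rw [hXw]
    exact sq_sum_le_card_mul_sum_sq
  have hsq : ∑ w, ((R.filter (G.Adj w)).card : ℝ) ^ 2 = ∑ r ∈ R, ∑ s ∈ R, (G.codegree r s : ℝ) := by
    exact_mod_cast (G.sum_codegree R).symm
  have hco : ∑ r ∈ R, ∑ s ∈ R, (G.codegree r s : ℝ) ≤ X + k * (k * (δ ^ 2 / 4 * n)) := by
    calc ∑ r ∈ R, ∑ s ∈ R, (G.codegree r s : ℝ)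
        ≤ ∑ r ∈ R, ∑ s ∈ R, ((if r = s then (G.degree r : ℝ) else 0) + δ ^ 2 / 4 * n) := by
          refine Finset.sum_le_sum fun r hr => Finset.sum_le_sum fun s hs => ?_
          split_ifs with h
          · subst h
            have : (G.codegree r r : ℝ) = G.degree r := by simp [codegree]
            rw [this]
            have : 0 ≤ δ ^ 2 / 4 * n := by positivity
            linarith
          · rw [zero_add]
            exact (hR r hr s hs h).le
      _ = X + k * (k * (δ ^ 2 / 4 * n)) := by
          simp only [Finset.sum_add_distrib, Finset.sum_const, nsmul_eq_mul, X, k]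
          congr 1
          exact Finset.sum_congr rfl fun r hr => by simp [hr]
  rw [hsq] at hCS
  -- From `kδ ≥ 2`; then `nX ≤ X²/2`, and the two bounds below give `X² ≤ 3X²/4`.
  have h2 : 2 * n ≤ X := by nlinarith
  have h3 : X ^ 2 ≤ n * X + (k * δ * n) ^ 2 / 4 := by
    calc X ^ 2 ≤ n * (X + k * (k * (δ ^ 2 / 4 * n))) := hCS.trans (by gcongr)
      _ = _ := by ring
  have h4 : (k * δ * n) ^ 2 ≤ X ^ 2 := by gcongr
  nlinarith

/-- A largest subset of `T` with pairwise small codegrees works: an uncovered vertex could be added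
to it. -/
lemma exists_codegree_cover {δ : ℝ} (hδ : 0 < δ) (hδ1 : δ < 1) [Nonempty V]
    (hdeg : ∀ v, δ * Fintype.card V ≤ G.degree v) (T : Finset V) :
    ∃ R ⊆ T, R.card * δ < 2 ∧
      ∀ u ∈ T, ∃ r ∈ R, δ ^ 2 / 4 * Fintype.card V ≤ (G.codegree u r : ℝ) := by
  classical
  have hn : (0 : ℝ) < Fintype.card V := by exact_mod_cast Fintype.card_pos
  obtain ⟨R, hR, hmax⟩ := Finset.exists_max_image
    (T.powerset.filter fun R : Finset V => ∀ r ∈ R, ∀ s ∈ R, r ≠ s →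
      (G.codegree r s : ℝ) < δ ^ 2 / 4 * Fintype.card V) Finset.card ⟨∅, by simp⟩
  simp only [Finset.mem_filter, Finset.mem_powerset] at hR hmax
  refine ⟨R, hR.1, G.card_mul_lt_two_of_codegree_lt hδ hdeg hR.2, fun u hu => ?_⟩
  by_contra! hcon
  have hself : δ ^ 2 / 4 * Fintype.card V ≤ (G.codegree u u : ℝ) := by
    have : (G.codegree u u : ℝ) = G.degree u := by simp [codegree]
    rw [this]
    refine le_trans ?_ (hdeg u)
    gcongr
    nlinarith
  have huR : u ∉ R := fun h => (hcon u h).not_ge hself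
  have hcomm : ∀ r, G.codegree r u = G.codegree u r := fun r => by
    simp [codegree, Finset.inter_comm]
  have := hmax (insert u R) ⟨Finset.insert_subset hu hR.1, by
    intro r hr s hs hrs
    rcases Finset.mem_insert.1 hr with rfl | hr' <;>
      rcases Finset.mem_insert.1 hs with rfl | hs'
    · exact absurd rfl hrs
    · exact hcon s ‹_›
    · rw [hcomm]
      exact hcon r ‹_›
    · exact hR.2 r ‹_› s ‹_› hrs⟩
  rw [Finset.card_insert_of_notMem huR] at this
  omega

/-- If `χ(G) ≥ 2/δ`, then some edge joins two vertices that both have a large codegree with a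
common third vertex. -/
lemma exists_adj_codegree {δ : ℝ} (hδ : 0 < δ) (hδ1 : δ < 1) [Nonempty V]
    (hdeg : ∀ v, δ * Fintype.card V ≤ G.degree v) (hχ : 2 ≤ G.chromaticNumber.toNat * δ) :
    ∃ u v r, G.Adj u v ∧ δ ^ 2 / 4 * Fintype.card V ≤ (G.codegree u r : ℝ) ∧
      δ ^ 2 / 4 * Fintype.card V ≤ (G.codegree v r : ℝ) := by
  obtain ⟨R, -, hRcard, hcov⟩ := G.exists_codegree_cover hδ hδ1 hdeg Finset.univ
  choose! f hfR hf using fun u => hcov u (Finset.mem_univ u)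
  by_contra! hcon
  -- Without such an edge, colouring each vertex by its representative is proper and uses fewer than
  -- `2/δ` colours.
  have C : G.Coloring R := Coloring.mk (fun u => ⟨f u, hfR u⟩) fun {u v} huv h => by
    have h' : f u = f v := congrArg Subtype.val h
    exact (hcon u v (f u) huv (hf u)).not_ge (h' ▸ hf v)
  have hle : G.chromaticNumber.toNat ≤ R.card := by
    have := C.colorable.chromaticNumber_le
    rw [Fintype.card_coe] at this
    exact ENat.toNat_le_of_le_natCast this
  have : (G.chromaticNumber.toNat : ℝ) ≤ R.card := by exact_mod_cast hle
  nlinarith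

variable {κ : Type*} [DecidableEq κ]

/-- The edges of `G` whose endpoints get the same colour. -/
def monochromatic (φ : V → κ) : SimpleGraph V where
  Adj x y := G.Adj x y ∧ φ x = φ y
  symm := ⟨fun _ _ h => ⟨h.1.symm, h.2.symm⟩⟩
  loopless := ⟨fun _ h => G.loopless.irrefl _ h.1⟩

instance (φ : V → κ) : DecidableRel (G.monochromatic φ).Adj :=
  fun x y => inferInstanceAs (Decidable (G.Adj x y ∧ φ x = φ y))

/-- With only two colours, each common neighbour shares its colour with `u` or `r`. -/
lemma codegree_le_of_ne {φ : V → Bool} {u r : V} (h : φ u ≠ φ r) :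
    G.codegree u r ≤ (G.monochromatic φ).degree u + (G.monochromatic φ).degree r := by
  unfold codegree
  rw [← card_neighborFinset_eq_degree, ← card_neighborFinset_eq_degree]
  refine (Finset.card_le_card fun w hw => ?_).trans (Finset.card_union_le _ _)
  simp only [Finset.mem_inter, mem_neighborFinset, Finset.mem_union] at hw ⊢
  change (G.Adj u w ∧ φ u = φ w) ∨ (G.Adj r w ∧ φ r = φ w)
  rcases hu : φ u <;> rcases hr : φ r <;> rcases hw' : φ w <;> simp_all

/-- The vertices with at least `t` neighbours of their own colour. -/
noncomputable def badVertices (φ : V → κ) (t : ℝ) : Finset V :=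
  open Classical in Finset.univ.filter fun v => t ≤ (G.monochromatic φ).degree v

omit [DecidableEq V] in
lemma mem_badVertices {φ : V → κ} {t : ℝ} {v : V} :
    v ∈ G.badVertices φ t ↔ t ≤ (G.monochromatic φ).degree v := by
  simp [badVertices]

omit [DecidableEq V] in
lemma card_badVertices_mul_le (φ : V → κ) {t : ℝ} :
    (G.badVertices φ t).card * t ≤ 2 * (G.monochromatic φ).edgeFinset.card := by
  have h1 : (∑ v, ((G.monochromatic φ).degree v : ℝ)) = 2 * (G.monochromatic φ).edgeFinset.card :=
    by exact_mod_cast (G.monochromatic φ).sum_degrees_eq_twice_card_edges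
  rw [← h1]
  calc (G.badVertices φ t).card * t = ∑ _v ∈ G.badVertices φ t, t := by simp
    _ ≤ ∑ v ∈ G.badVertices φ t, ((G.monochromatic φ).degree v : ℝ) :=
      Finset.sum_le_sum fun v hv => G.mem_badVertices.1 hv
    _ ≤ _ := Finset.sum_le_sum_of_subset_of_nonneg (Finset.subset_univ _) fun _ _ _ => by positivity

lemma mem_badVertices_or {φ : V → Bool} {u r : V} {t : ℝ} (ht : 2 * t ≤ G.codegree u r)
    (h : φ u ≠ φ r) : u ∈ G.badVertices φ t ∨ r ∈ G.badVertices φ t := by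
  simp only [mem_badVertices]
  by_contra! hcon
  have : (G.codegree u r : ℝ) ≤ (G.monochromatic φ).degree u + (G.monochromatic φ).degree r := by
    exact_mod_cast G.codegree_le_of_ne h
  linarith

end SimpleGraph

/-! ### Encoding colourings and summing their weights -/

namespace SimpleGraph

variable {V : Type*} [Fintype V] [DecidableEq V]

/-- The partial colouring obtained from `φ` by forgetting the colours outside `T`. -/
def partialColoring (φ : V → Bool) (T : Finset V) : V → Option Bool :=
  fun w => if w ∈ T then some (φ w) else none

omit [Fintype V] in
lemma isSome_partialColoring (φ : V → Bool) (T : Finset V) (w : V) :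
    (partialColoring φ T w).isSome ↔ w ∈ T := by
  unfold partialColoring
  split_ifs <;> simp_all

omit [Fintype V] in
lemma partialColoring_eq {φ ψ : V → Bool} {S T : Finset V}
    (h : partialColoring φ S = partialColoring ψ T) : S = T ∧ ∀ w ∈ S, φ w = ψ w := by
  have hST : S = T := by
    ext w
    rw [← isSome_partialColoring φ, ← isSome_partialColoring ψ, h]
  refine ⟨hST, fun w hw => ?_⟩
  have := congrFun h w
  simpa [partialColoring, hw, ← hST] using this

/-- The sum factors over vertices: `none` contributes 1 and each of the two colours `y`. -/
lemma sum_pow_card_isSome (y : ℝ) :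
    ∑ h : V → Option Bool, y ^ (Finset.univ.filter fun w => (h w).isSome).card
      = (1 + 2 * y) ^ Fintype.card V := by
  have h1 : ∀ h : V → Option Bool, y ^ (Finset.univ.filter fun w => (h w).isSome).card
      = ∏ w, if (h w).isSome then y else 1 := fun h => by
    rw [Finset.prod_ite, Finset.prod_const, Finset.prod_const_one, mul_one]
  simp_rw [h1]
  have := (Finset.prod_univ_sum (fun _ : V => (Finset.univ : Finset (Option Bool)))
    (fun _ c => if c.isSome then y else 1)).symm
  rw [Fintype.piFinset_univ] at this
  rw [this]
  simp only [Fintype.sum_option, Fintype.sum_bool, Option.isSome_some, Option.isSome_none,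
    if_true, Finset.prod_const, Finset.card_univ, Bool.false_eq_true, if_false]
  congr 1
  ring

lemma sum_pow_card_isSome_le {κ : Type*} (s : Finset κ)
    {f g : κ → V → Option Bool} (hfg : ∀ i j, f i = f j → g i = g j → i = j) {y : ℝ} (hy : 0 ≤ y) :
    ∑ i ∈ s, y ^ (Finset.univ.filter fun w => (f i w).isSome).card *
        y ^ (Finset.univ.filter fun w => (g i w).isSome).card
      ≤ (1 + 2 * y) ^ Fintype.card V * (1 + 2 * y) ^ Fintype.card V := by
  classical
  rw [← sum_pow_card_isSome, Finset.sum_mul_sum, ← Fintype.sum_prod_type',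
    ← Finset.sum_image (s := s) (g := fun i => (f i, g i))
      (f := fun c : (V → Option Bool) × (V → Option Bool) =>
        y ^ (Finset.univ.filter fun w => (c.1 w).isSome).card *
          y ^ (Finset.univ.filter fun w => (c.2 w).isSome).card)
      fun i _ j _ h => hfg i j (congrArg Prod.fst h) (congrArg Prod.snd h)]
  exact Finset.sum_le_sum_of_subset_of_nonneg (Finset.subset_univ _) fun _ _ _ => by positivity

variable (G : SimpleGraph V) [DecidableRel G.Adj]

/-- If `R` is a codegree cover of the complement of the bad vertices, then the colours of the bad
vertices and of `R` determine the colouring. -/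
lemma eq_of_partialColoring_eq {t : ℝ} {R : (V → Bool) → Finset V}
    (hRb : ∀ φ, R φ ⊆ (G.badVertices φ t)ᶜ)
    (hR : ∀ φ, ∀ u ∈ (G.badVertices φ t)ᶜ, ∃ r ∈ R φ, 2 * t ≤ (G.codegree u r : ℝ))
    {φ ψ : V → Bool}
    (h1 : partialColoring φ (G.badVertices φ t) = partialColoring ψ (G.badVertices ψ t))
    (h2 : partialColoring φ (R φ) = partialColoring ψ (R ψ)) : φ = ψ := by
  obtain ⟨hD, hDc⟩ := partialColoring_eq h1
  obtain ⟨hRR, hRc⟩ := partialColoring_eq h2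
  have key : ∀ χ : V → Bool, ∀ u r, u ∉ G.badVertices χ t → r ∈ R χ →
      2 * t ≤ (G.codegree u r : ℝ) → χ u = χ r := by
    intro χ u r hu hr ht
    by_contra hne
    exact (G.mem_badVertices_or ht hne).elim hu (Finset.mem_compl.1 (hRb χ hr))
  funext u
  by_cases hu : u ∈ G.badVertices φ t
  · exact hDc u hu
  · obtain ⟨r, hr, ht⟩ := hR φ u (Finset.mem_compl.2 hu)
    rw [key φ u r hu hr ht, hRc r hr, key ψ u r (hD ▸ hu) (hRR ▸ hr) ht]

lemma one_add_inv_pow_lt (n : ℕ) (hn : 2 ≤ n) : (1 + 2 * ((n : ℝ) ^ 2)⁻¹) ^ n < 3 := by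
  have hn' : (2 : ℝ) ≤ n := by exact_mod_cast hn
  have h : 2 * ((n : ℝ) ^ 2)⁻¹ * n ≤ 1 := by
    have : 2 * ((n : ℝ) ^ 2)⁻¹ * n = 2 / n := by field_simp
    rw [this, div_le_one (by linarith)]
    exact hn'
  calc (1 + 2 * ((n : ℝ) ^ 2)⁻¹) ^ n ≤ Real.exp (2 * ((n : ℝ) ^ 2)⁻¹) ^ n := by
        gcongr
        rw [add_comm]
        exact Real.add_one_le_exp _
    _ = Real.exp (2 * ((n : ℝ) ^ 2)⁻¹ * n) := by rw [← Real.exp_nat_mul, mul_comm]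
    _ ≤ Real.exp 1 := Real.exp_le_exp.2 h
    _ < 3 := Real.exp_one_lt_three

omit [DecidableEq V] in
lemma weight_monochromatic_le {δ : ℝ} (hδ : 0 < δ) [Nonempty V]
    {L : ℝ} (hL : L = Real.logb 2 (Fintype.card V)) (hLδ : 2 / δ ≤ L) (hL1 : 1 ≤ L)
    {b : ℕ} (hb : 0 < b) (hbL : (b : ℝ) ≤ δ ^ 2 * Fintype.card V / (6400 * L ^ 2))
    {φ : V → Bool} (hD : (G.badVertices φ (δ ^ 2 / 8 * Fintype.card V)).Nonempty)
    {R : Finset V} (hR : R.card * δ < 2) :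
    MakerBreaker.weight b (G.monochromatic φ).edgeFinset ≤ 2 ^ (-5 : ℝ) *
      ((((Fintype.card V : ℝ) ^ 2)⁻¹) ^ (G.badVertices φ (δ ^ 2 / 8 * Fintype.card V)).card *
        (((Fintype.card V : ℝ) ^ 2)⁻¹) ^ R.card) := by
  have hn : (0 : ℝ) < Fintype.card V := by exact_mod_cast Fintype.card_pos
  have hm := G.card_badVertices_mul_le φ (t := δ ^ 2 / 8 * Fintype.card V)
  have hd : (1 : ℝ) ≤ (G.badVertices φ (δ ^ 2 / 8 * Fintype.card V)).card := by
    exact_mod_cast Finset.card_pos.2 hD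
  generalize (G.badVertices φ (δ ^ 2 / 8 * Fintype.card V)).card = d at *
  unfold MakerBreaker.weight
  generalize (G.monochromatic φ).edgeFinset.card = m at *
  have hb' : (0 : ℝ) < b := by exact_mod_cast hb
  have hy : ((Fintype.card V : ℝ) ^ 2)⁻¹ = 2 ^ (-(2 * L)) := by
    rw [Real.rpow_neg two_pos.le, mul_comm, Real.rpow_mul two_pos.le, hL,
      Real.rpow_logb two_pos (by norm_num) hn, Real.rpow_two]
  rw [hy, ← Real.rpow_mul_natCast two_pos.le, ← Real.rpow_mul_natCast two_pos.le,
    ← Real.rpow_add two_pos, ← Real.rpow_add two_pos]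
  refine Real.rpow_le_rpow_of_exponent_le one_le_two ?_
  generalize (Fintype.card V : ℝ) = n at *
  -- Here `m ≥ dδ²n/16`, and 400 = 6400/16. Only `5 + 2Ld + 2L|R|` is needed, which is at most
  -- `9L²d`.
  have hmb : 400 * L ^ 2 * d ≤ m / b := by
    rw [le_div_iff₀ hb']
    calc 400 * L ^ 2 * d * b ≤ 400 * L ^ 2 * d * (δ ^ 2 * n / (6400 * L ^ 2)) := by gcongr
      _ = d * (δ ^ 2 / 8 * n) / 2 := by
        field_simp
        norm_num
      _ ≤ m := by linarith
  have hRL : (R.card : ℝ) ≤ L := by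
    have : (R.card : ℝ) < 2 / δ := by rwa [lt_div_iff₀ hδ]
    linarith
  have h1 : (R.card : ℝ) * L ≤ L ^ 2 := by
    rw [sq]
    gcongr
  have h2 : L * d ≤ L ^ 2 * d := by
    gcongr
    nlinarith
  have h3 : L ^ 2 ≤ L ^ 2 * d := le_mul_of_one_le_right (by positivity) hd
  have h4 : 1 ≤ L ^ 2 := by nlinarith
  rw [neg_div]
  linarith

lemma sum_weight_monochromatic_lt {δ : ℝ} (hδ : 0 < δ) (hδ1 : δ < 1) [Nonempty V]
    (hdeg : ∀ v, δ * Fintype.card V ≤ G.degree v)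
    {L : ℝ} (hL : L = Real.logb 2 (Fintype.card V)) (hLδ : 2 / δ ≤ L) (hL1 : 1 ≤ L)
    {b : ℕ} (hb : 0 < b) (hbL : (b : ℝ) ≤ δ ^ 2 * Fintype.card V / (6400 * L ^ 2))
    {u v r : V} (hu : δ ^ 2 / 4 * Fintype.card V ≤ (G.codegree u r : ℝ))
    (hv : δ ^ 2 / 4 * Fintype.card V ≤ (G.codegree v r : ℝ)) :
    ∑ φ : V → Bool with φ u ≠ φ v,
      MakerBreaker.weight b (G.monochromatic φ).edgeFinset < 1 / 2 := by
  set t : ℝ := δ ^ 2 / 8 * Fintype.card V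
  have ht : δ ^ 2 / 4 * Fintype.card V = 2 * t := by
    simp only [t]
    ring
  have hn2 : 2 ≤ Fintype.card V := by
    have hn : (0 : ℝ) < Fintype.card V := by exact_mod_cast Fintype.card_pos
    rw [hL, Real.le_logb_iff_rpow_le one_lt_two hn, Real.rpow_one] at hL1
    exact_mod_cast hL1
  choose R hRb hRcard hR using fun φ : V → Bool =>
    G.exists_codegree_cover hδ hδ1 hdeg (G.badVertices φ t)ᶜ
  rw [ht] at hu hv
  simp_rw [ht] at hR
  set y : ℝ := ((Fintype.card V : ℝ) ^ 2)⁻¹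
  have hy : 0 ≤ y := by positivity
  have hsupp : ∀ (φ : V → Bool) T,
      (Finset.univ.filter fun w => (partialColoring φ T w).isSome).card = T.card := fun φ T => by
    simp [isSome_partialColoring]
  have hbad : ∀ φ : V → Bool, φ u ≠ φ v → (G.badVertices φ t).Nonempty := by
    intro φ hφ
    -- As `u` and `v` differ in colour, `r` differs from one of them.
    by_cases h : φ u = φ r
    · exact (G.mem_badVertices_or hv fun h' => hφ (h.trans h'.symm)).elim
        (fun h => ⟨_, h⟩) fun h => ⟨_, h⟩
    · exact (G.mem_badVertices_or hu h).elim (fun h => ⟨_, h⟩) fun h => ⟨_, h⟩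
  have hone : (1 + 2 * y) ^ Fintype.card V < 3 :=
    one_add_inv_pow_lt _ hn2
  have hcode := sum_pow_card_isSome_le (Finset.univ.filter fun φ : V → Bool => φ u ≠ φ v)
    (fun _ _ => G.eq_of_partialColoring_eq hRb hR) hy
  simp only [hsupp] at hcode
  have hweight : ∀ φ ∈ Finset.univ.filter fun φ : V → Bool => φ u ≠ φ v,
      MakerBreaker.weight b (G.monochromatic φ).edgeFinset
        ≤ 2 ^ (-5 : ℝ) * (y ^ (G.badVertices φ t).card * y ^ (R φ).card) := fun φ hφ =>
    G.weight_monochromatic_le hδ hL hLδ hL1 hb hbL (hbad φ (Finset.mem_filter.1 hφ).2) (hRcard φ)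
  have hsum := Finset.sum_le_sum hweight
  rw [← Finset.mul_sum] at hsum
  have h5 : (2 : ℝ) ^ (-5 : ℝ) = 1 / 32 := by
    rw [Real.rpow_neg two_pos.le]
    norm_num
  rw [h5] at hsum
  have hpos : 0 ≤ (1 + 2 * y) ^ Fintype.card V := by positivity
  generalize (1 + 2 * y) ^ Fintype.card V = z at hone hpos hcode
  -- The total weight is at most `z²/32`, so this crude bound is enough.
  have hz : z * z < 16 := by nlinarith
  linarith

omit [DecidableEq V] in
lemma not_colorable_of_hits_monochromatic {T : Finset (Sym2 V)} (hT : T ⊆ G.edgeFinset)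
    (h : ∀ φ : V → Bool, ¬ Disjoint (G.monochromatic φ).edgeFinset T) :
    T ∈ MakerBreaker.nonColorable G 2 := by
  have hTG : ∀ e ∈ T, e ∈ G.edgeSet := fun e he => mem_edgeFinset.1 (hT he)
  refine ⟨fromEdgeSet T, fun x y hxy => ?_, fun hcol => ?_, ?_⟩
  · exact hTG _ (by simpa using ((fromEdgeSet_adj _).1 hxy).1)
  · have C : (fromEdgeSet (T : Set (Sym2 V))).Coloring Bool := hcol.toColoring (by simp)
    refine h C (Finset.disjoint_left.2 fun e => ?_)
    induction e with | _ x y => ?_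
    intro he hxy
    rw [mem_edgeFinset, mem_edgeSet] at he
    exact C.valid ((fromEdgeSet_adj _).2 ⟨by simpa using hxy, he.1.ne⟩) he.2
  · rw [edgeSet_fromEdgeSet, eq_comm, sdiff_eq_left, Set.disjoint_left]
    exact fun e he hdiag => G.not_isDiag_of_mem_edgeSet (hTG e he) hdiag

end SimpleGraph

/-! ### Assembling the strategy -/

lemma MakerBreaker.MakerHasWinningStrategy.mono {α : Type*} [DecidableEq α] {X : Finset α}
    {F F' : Set (Finset α)} {a b : ℕ} (h : MakerHasWinningStrategy X F a b) (hF : F ⊆ F') :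
    MakerHasWinningStrategy X F' a b := by
  obtain ⟨σ, hσ⟩ := h
  refine ⟨σ, hσ.legal, fun M B hr hX => ?_⟩
  obtain ⟨A, hA, hAM⟩ := hσ.wins M B hr hX
  exact ⟨A, hF hA, hAM⟩

theorem theorem1p1 (δ : ℝ) (hδ0 : 0 < δ) (hδ1 : δ < 1) :
    ∃ n₀ : ℕ, ∀ (V : Type*) [Fintype V] [DecidableEq V] (G : SimpleGraph V) [DecidableRel G.Adj]
      (n : ℕ), Fintype.card V = n → n₀ ≤ n →
      δ * (n : ℝ) ≤ (G.minDegree : ℝ) →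
      32 / δ < (G.chromaticNumber.toNat : ℝ) →
      ∀ b : ℕ, 0 < b → (b : ℝ) ≤ δ ^ 2 * (n : ℝ) / (6400 * (Real.logb 2 (n : ℝ)) ^ 2) →
        MakerBreaker.MakerHasWinningStrategy G.edgeFinset (MakerBreaker.nonColorable G 2) 1 b := by
  -- This makes `log₂ n ≥ 2/δ`, so the logarithm bounds the number of representatives.
  refine ⟨⌈(2 : ℝ) ^ (2 / δ)⌉₊, ?_⟩
  rintro V _ _ G _ n rfl hn hdeg hχ b hb hbL
  have hn' : (2 : ℝ) ^ (2 / δ) ≤ Fintype.card V := Nat.ceil_le.1 hn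
  have hpos : (0 : ℝ) < Fintype.card V := (by positivity : (0 : ℝ) < 2 ^ (2 / δ)).trans_le hn'
  have : Nonempty V := Fintype.card_pos_iff.1 (by exact_mod_cast hpos)
  have hdeg' : ∀ v, δ * Fintype.card V ≤ G.degree v := fun v =>
    hdeg.trans (by exact_mod_cast G.minDegree_le_degree v)
  have hLδ : 2 / δ ≤ Real.logb 2 (Fintype.card V) :=
    (Real.le_logb_iff_rpow_le one_lt_two hpos).2 hn'
  have hL1 : 1 ≤ Real.logb 2 (Fintype.card V) := by
    refine le_trans ?_ hLδ
    rw [le_div_iff₀ hδ0]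
    linarith
  rw [div_lt_iff₀ hδ0] at hχ
  obtain ⟨u, v, r, huv, hu, hv⟩ := G.exists_adj_codegree hδ0 hδ1 hdeg' (by linarith)
  have hsum := G.sum_weight_monochromatic_lt hδ0 hδ1 hdeg' rfl hLδ hL1 hb hbL hu hv
  have hmem : ∀ φ : V → Bool, s(u, v) ∉ (G.monochromatic φ).edgeFinset ↔ φ u ≠ φ v := fun φ => by
    rw [SimpleGraph.mem_edgeFinset, SimpleGraph.mem_edgeSet]
    exact not_congr ⟨fun h => h.2, fun h => ⟨huv, h⟩⟩
  refine (MakerBreaker.makerHasWinningStrategy_hitting G.edgeFinset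
    (fun φ : V → Bool => (G.monochromatic φ).edgeFinset)
    (fun φ => SimpleGraph.edgeFinset_mono fun _ _ h => h.1) hb
    (e₀ := s(u, v)) (SimpleGraph.mem_edgeFinset.2 huv) ?_).mono ?_
  · simpa only [hmem] using hsum
  · rintro T ⟨hT, -, h⟩
    exact G.not_colorable_of_hits_monochromatic hT h
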